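/- Theorem (high-probability regret of SCB-IX). Consider the adversarial bandit game with $n\ge 2$ actions and $T\ge 1$ rounds. In round $t$ an adaptive adversary chooses a loss vector $\ell_t\in\mathbb R^n$ as an arbitrary function of the player's actions $k_1,\dots,k_{t-1}$; the player simultaneously chooses $k_t\in[n]$ and observes only $\ell_{t,k_t}$. Let $\ell_\infty$ be the maximum of $|\ell_{t,k}|$ over $t\in[T]$, $k\in[n]$ and all possible sequences of past actions (a deterministic number, not known to the player), and let $\mathcal R(T)=\sum_{t=1}^T\ell_{t,k_t}-\min_{k\in[n]}\sum_{t=1}^T\ell_{t,k}$. Algorithm SCB-IX: let $\Psi(p)=\log n+\sum_k p_k\log p_k$, let $\Delta_n$ be the probability simplex, and start with $C_1=0$, $\eta_1=\infty$, $\gamma_1=0$. With $\beta_t=\sqrt{\frac{n\log n}{n\log n+t}}$, in round $t=1,\dots,T$: (i) compute $p_t\in\arg\min_{p\in\Delta_n}\big(\sum_{s<t}\langle\hat\ell_s,p\rangle+\frac1{\eta_t}\Psi(p)\big)$, where $1/\infty=0$ (ties, which occur only if $C_t=0$, are broken arbitrarily); (ii) draw $k_t$ from $q_t=(1-\beta_t)p_t+\beta_t\mathbf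 1/n$ and observe $\ell_{t,k_t}$; (iii) put $\hat\ell_{t,k}=\frac{\max(-C_t,\min(C_t,\ell_{t,k}))+C_t}{q_{t,k}+\gamma_t}\,\mathbb 1\{k=k_t\}$ for $k\in[n]$; (iv) put $C_{t+1}=2|\ell_{t,k_t}|$ if $|\ell_{t,k_t}|>C_t$ and $C_{t+1}=C_t$ otherwise; if $C_{t+1}>0$, put $\eta_{t+1}=\frac1{C_{t+1}}\sqrt{\frac{\log n}{n(t+1)}}$ and $\gamma_{t+1}=\eta_{t+1}C_{t+1}/2$; if $C_{t+1}=0$, put $\eta_{t+1}=\infty$ and $\gamma_{t+1}=0$. There is an absolute constant $c>0$ such that for all $n\ge2$, $T\ge1$, all adversaries, all choices of the minimizers in (i), and all $\delta\in(0,1)$, with probability at least $1-\delta$, $$\mathcal R(T)\le c\left(\ell_\infty\sqrt{\frac{n^2+nT}{\log n}}\,\log(1/\delta)+\ell_\infty\sqrt{nT\log n}\right).$$ -/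

import Mathlib

namespace SCBIX

noncomputable section

/-!  Histories. The actions played in rounds `1, …, t - 1` are recorded as a list of length `t - 1`,
the most recent action first. So the history `h` is what is known at the beginning of round
`h.length + 1`. -/

/-- An adaptive adversary: the loss vector of a round is an arbitrary function of the actions
that the player has chosen in the previous rounds (round `h.length + 1` gets `ℓ h`). -/
abbrev Adversary (n : ℕ) := List (Fin n) → Fin n → ℝ

/-- A player's rule: for every history, a vector of weights on the actions. -/
abbrev Rule (n : ℕ) := List (Fin n) → Fin n → ℝ

/-- The number of the round that is played after the history `h`. -/
def round {n : ℕ} (h : List (Fin n)) : ℕ := h.length + 1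

/-- Clipping to `[-C, C]`. -/
def clip (C x : ℝ) : ℝ := max (-C) (min C x)

/-- The clipping threshold `C_t`: `C_1 = 0`, and after playing `k`,
`C_{t+1} = 2 |ℓ_{t,k}|` if `|ℓ_{t,k}| > C_t` and `C_{t+1} = C_t` otherwise. -/
def threshold {n : ℕ} (ℓ : Adversary n) : List (Fin n) → ℝ
  | [] => 0
  | k :: h => if threshold ℓ h < |ℓ h k| then 2 * |ℓ h k| else threshold ℓ h

/-- The exploration rate `β_t = √(n log n / (n log n + t))`. -/
def explorationRate (n t : ℕ) : ℝ :=
  √((n : ℝ) * Real.log n / ((n : ℝ) * Real.log n + t))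

/-- The inverse `1 / η_t` of the learning rate `η_t = (1 / C_t) √(log n / (n t))`. As long as
`C_t = 0`, in particular for `t = 1`, one has `η_t = ∞` and `1 / η_t = 0`. -/
def invLearningRate {n : ℕ} (ℓ : Adversary n) (h : List (Fin n)) : ℝ :=
  threshold ℓ h * √((n : ℝ) * (round h : ℝ) / Real.log n)

/-- The implicit exploration rate `γ_t = η_t C_t / 2 = (1 / 2) √(log n / (n t))`, and `γ_t = 0` as
long as `C_t = 0`, in particular for `t = 1`. (If `C_t = 0`, the loss estimate below is `0`,
whatever `γ_t` is.) -/
def implicitRate {n : ℕ} (ℓ : Adversary n) (h : List (Fin n)) : ℝ :=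
  if threshold ℓ h = 0 then 0 else √(Real.log n / ((n : ℝ) * (round h : ℝ))) / 2

/-- Mixing with the uniform distribution: `q_t = (1 - β_t) p_t + β_t 𝟏 / n`. -/
def mix {n : ℕ} (p : Rule n) (h : List (Fin n)) (i : Fin n) : ℝ :=
  (1 - explorationRate n (round h)) * p h i + explorationRate n (round h) / n

/-- The loss estimate of the round after the history `h`, if action `k` is played in it:
`(ℓ^c_{t,i} + C_t) / (q_{t,i} + γ_t)` for `i = k`, and `0` for the other actions. -/
def lossEstimate {n : ℕ} (ℓ : Adversary n) (p : Rule n) (h : List (Fin n)) (k i : Fin n) : ℝ :=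
  if i = k then
    (clip (threshold ℓ h) (ℓ h i) + threshold ℓ h) / (mix p h i + implicitRate ℓ h)
  else 0

/-- The sum of the loss estimates of all past rounds. -/
def cumEstimate {n : ℕ} (ℓ : Adversary n) (p : Rule n) : List (Fin n) → Fin n → ℝ
  | [], _ => 0
  | k :: h, i => cumEstimate ℓ p h i + lossEstimate ℓ p h k i

/-- The (negative, shifted) Shannon entropy `Ψ(x) = log n + ∑ x_i log x_i`, with `0 log 0 = 0`. -/
def shannon {n : ℕ} (x : Fin n → ℝ) : ℝ := Real.log n + ∑ i, x i * Real.log (x i)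

/-- The objective `∑_{s<t} ⟨ℓ̂_s, x⟩ + Ψ(x) / η_t`. -/
def objective {n : ℕ} (ℓ : Adversary n) (p : Rule n) (h : List (Fin n)) (x : Fin n → ℝ) : ℝ :=
  ∑ i, cumEstimate ℓ p h i * x i + invLearningRate ℓ h * shannon x

/-- `p` is the sequence of action distributions `p_t` that SCB-IX computes against `ℓ`: after every
history, `p h` minimizes the objective over the probability simplex. (The minimizer is unique
unless `C_t = 0`, where every point of the simplex is one, and may be chosen.) -/
def IsSCBIX {n : ℕ} (ℓ : Adversary n) (p : Rule n) : Prop :=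
  ∀ h : List (Fin n), p h ∈ stdSimplex ℝ (Fin n) ∧
    IsMinOn (objective ℓ p h) (stdSimplex ℝ (Fin n)) (p h)

/-- The probability that the actions `h` are played in the first `h.length` rounds, when the
action of each round is drawn from `q_t` given the past. -/
def playProb {n : ℕ} (p : Rule n) : List (Fin n) → ℝ
  | [] => 1
  | k :: h => mix p h k * playProb p h

open Classical in
/-- The probability that the sequence of the first `T` actions has the property `E`. -/
def prob {n : ℕ} (p : Rule n) (T : ℕ) (E : List (Fin n) → Prop) : ℝ :=
  ∑ a : List.Vector (Fin n) T, if E a.toList then playProb p a.toList else 0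

/-- The total loss of the player, `∑_t ℓ_{t,k_t}`. -/
def playerLoss {n : ℕ} (ℓ : Adversary n) : List (Fin n) → ℝ
  | [] => 0
  | k :: h => playerLoss ℓ h + ℓ h k

/-- The total loss `∑_t ℓ_{t,i}` of the fixed action `i` along the loss vectors that were chosen. -/
def actionLoss {n : ℕ} (ℓ : Adversary n) (i : Fin n) : List (Fin n) → ℝ
  | [] => 0
  | _ :: h => actionLoss ℓ i h + ℓ h i

/-- The regret `∑_t ℓ_{t,k_t} - min_i ∑_t ℓ_{t,i}` (the infimum is over the finite set of actions,
so it is a minimum). -/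
def regret {n : ℕ} (ℓ : Adversary n) (h : List (Fin n)) : ℝ :=
  playerLoss ℓ h - ⨅ i : Fin n, actionLoss ℓ i h

/-- The scale of the losses `ℓ_∞ = max |ℓ_{t,i}|` over the rounds `1 ≤ t ≤ T`, the actions `i` and,
as the loss vectors depend on the past actions, all histories of length `t - 1` (a supremum over
a finite set, so a maximum). -/
def lossScale {n : ℕ} (ℓ : Adversary n) (T : ℕ) : ℝ :=
  ⨆ x : (Σ t : Fin T, List.Vector (Fin n) t) × Fin n, |ℓ x.1.2.toList x.2|

end

end SCBIX

/-! Write `u` for the clipped loss shifted by the threshold `C_t`, so `0 ≤ u ≤ 2 C_t`, and `M` for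
the scale of the losses. The true loss is `u - C_t` up to the excess of its modulus over `C_t`, and
the shift cancels when two actions are compared in the same round. Hence the regret against a fixed
action `i` splits into five pieces (`playerLoss_sub_actionLoss_le`).

Clipping errors on played actions sum to at most the final threshold, since each of them raises the
threshold by at least its size. Follow-the-regularized-leader, applied to the estimates, costs `log
n / η` plus a stability term (`runSum_sub_stability_le`). Stability and exploration bias form a
nonnegative `overhead`, of size `O(n M)` and conditional mean `O(M √(n log n / t))`. Implicit
exploration makes the estimate of action `i` exceed its true sum by little. The clipping error on
`i` in rounds where `i` is not played is invisible to the algorithm, but forced exploration plays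
`i` with probability at least `β_T / n`, so a large total would be noticed.

The last three pieces are random. Each is controlled by an exponential supermartingale, one for the
overhead and two for each action. Markov's inequality for the sum of all `2 n + 1` of them bounds
every exponent by `Λ = 3 log n + log (1 / δ)` at once. This settles `T ≥ n log n`; for shorter games
the trivial bound `2 M T` suffices. -/

namespace SCBIX

/-! ### Sums and exponential supermartingales along a history -/

/-- The sum of `f` over the rounds of a history: `f h k` is the contribution of the round in which
`k` is played after the history `h`. -/
def runSum {n : ℕ} (f : List (Fin n) → Fin n → ℝ) : List (Fin n) → ℝ
  | [] => 0
  | k :: h => runSum f h + f h k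

theorem playerLoss_eq_runSum {n : ℕ} (ℓ : Adversary n) (h : List (Fin n)) :
    playerLoss ℓ h = runSum ℓ h := by
  induction h with
  | nil => rfl
  | cons k h ih => simp [playerLoss, runSum, ih]

theorem actionLoss_eq_runSum {n : ℕ} (ℓ : Adversary n) (i : Fin n) (h : List (Fin n)) :
    actionLoss ℓ i h = runSum (fun h _ => ℓ h i) h := by
  induction h with
  | nil => rfl
  | cons k h ih => simp [actionLoss, runSum, ih]

theorem cumEstimate_eq_runSum {n : ℕ} (ℓ : Adversary n) (p : Rule n) (i : Fin n)
    (h : List (Fin n)) :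
    cumEstimate ℓ p h i = runSum (fun h k => lossEstimate ℓ p h k i) h := by
  induction h with
  | nil => rfl
  | cons k h ih => simp [cumEstimate, runSum, ih]

theorem runSum_le_runSum {n T : ℕ} {f g : List (Fin n) → Fin n → ℝ}
    (hfg : ∀ h k, h.length < T → f h k ≤ g h k) :
    ∀ h : List (Fin n), h.length ≤ T → runSum f h ≤ runSum g h
  | [], _ => le_rfl
  | k :: h, hT => by
    have hT' : h.length < T := by simpa using hT
    exact add_le_add (runSum_le_runSum hfg h hT'.le) (hfg h k hT')

theorem runSum_add {n : ℕ} (f g : List (Fin n) → Fin n → ℝ) (h : List (Fin n)) :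
    runSum (fun h k => f h k + g h k) h = runSum f h + runSum g h := by
  induction h with
  | nil => simp [runSum]
  | cons k h ih => simp only [runSum, ih]; ring

theorem runSum_sub {n : ℕ} (f g : List (Fin n) → Fin n → ℝ) (h : List (Fin n)) :
    runSum (fun h k => f h k - g h k) h = runSum f h - runSum g h := by
  induction h with
  | nil => simp [runSum]
  | cons k h ih => simp only [runSum, ih]; ring

theorem runSum_const_mul {n : ℕ} (c : ℝ) (f : List (Fin n) → Fin n → ℝ) (h : List (Fin n)) :
    runSum (fun h k => c * f h k) h = c * runSum f h := by
  induction h with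
  | nil => simp [runSum]
  | cons k h ih => simp only [runSum, ih]; ring

/-- A sum of increments of a potential telescopes. -/
theorem runSum_le_of_increment {n T : ℕ} {f : List (Fin n) → Fin n → ℝ} {Φ : List (Fin n) → ℝ}
    (h₀ : 0 ≤ Φ []) (hstep : ∀ h k, h.length < T → Φ h + f h k ≤ Φ (k :: h)) :
    ∀ h : List (Fin n), h.length ≤ T → runSum f h ≤ Φ h
  | [], _ => h₀
  | k :: h, hT => by
    have hT' : h.length < T := by simpa using hT
    have := runSum_le_of_increment h₀ hstep h hT'.le
    have := hstep h k hT'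
    simp only [runSum]
    linarith

/-- The expectation of a function of the first `T` actions. -/
noncomputable def expect {n : ℕ} (p : Rule n) (T : ℕ) (F : List (Fin n) → ℝ) : ℝ :=
  ∑ a : List.Vector (Fin n) T, playProb p a.toList * F a.toList

/-- Head and tail of a nonempty vector. -/
def vectorConsEquiv (α : Type*) (T : ℕ) : List.Vector α (T + 1) ≃ List.Vector α T × α where
  toFun v := (v.tail, v.head)
  invFun x := x.2 ::ᵥ x.1
  left_inv v := by simp
  right_inv x := by simp

theorem expect_zero {n : ℕ} (p : Rule n) (F : List (Fin n) → ℝ) : expect p 0 F = F [] := by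
  simp [expect, playProb]

theorem expect_succ {n : ℕ} (p : Rule n) (T : ℕ) (F : List (Fin n) → ℝ) :
    expect p (T + 1) F = expect p T (fun h => ∑ k, mix p h k * F (k :: h)) := by
  unfold expect
  rw [← (vectorConsEquiv (Fin n) T).symm.sum_comp, Fintype.sum_prod_type]
  refine Finset.sum_congr rfl fun v _ => ?_
  rw [Finset.mul_sum]
  refine Finset.sum_congr rfl fun k _ => ?_
  simp only [vectorConsEquiv, Equiv.coe_fn_symm_mk, List.Vector.toList_cons, playProb]
  ring

theorem playProb_nonneg {n : ℕ} {p : Rule n} (hq : ∀ h k, 0 ≤ mix p h k) :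
    ∀ h : List (Fin n), 0 ≤ playProb p h
  | [] => zero_le_one
  | k :: h => mul_nonneg (hq h k) (playProb_nonneg hq h)

theorem expect_mono {n T : ℕ} {p : Rule n} (hq : ∀ h k, 0 ≤ mix p h k)
    {F G : List (Fin n) → ℝ} (hFG : ∀ h, h.length = T → F h ≤ G h) :
    expect p T F ≤ expect p T G :=
  Finset.sum_le_sum fun a _ =>
    mul_le_mul_of_nonneg_left (hFG _ a.toList_length) (playProb_nonneg hq _)

theorem expect_add {n : ℕ} (p : Rule n) (T : ℕ) (F G : List (Fin n) → ℝ) :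
    expect p T (fun h => F h + G h) = expect p T F + expect p T G := by
  simp [expect, mul_add, Finset.sum_add_distrib]

theorem expect_const_mul {n : ℕ} (p : Rule n) (T : ℕ) (c : ℝ) (F : List (Fin n) → ℝ) :
    expect p T (fun h => c * F h) = c * expect p T F := by
  simp only [expect, Finset.mul_sum]
  exact Finset.sum_congr rfl fun a _ => by ring

theorem expect_sum {n : ℕ} {ι : Type*} (s : Finset ι) (p : Rule n) (T : ℕ)
    (F : ι → List (Fin n) → ℝ) :
    expect p T (fun h => ∑ i ∈ s, F i h) = ∑ i ∈ s, expect p T (F i) := by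
  simp only [expect, Finset.mul_sum]
  exact Finset.sum_comm

theorem expect_one {n : ℕ} {p : Rule n} (hq : ∀ h, ∑ k, mix p h k = 1) (T : ℕ) :
    expect p T (fun _ => 1) = 1 := by
  induction T with
  | zero => exact expect_zero _ _
  | succ T ih => simpa [expect_succ, hq] using ih

/-- The expectation of an exponential supermartingale is at most `1`. -/
theorem expect_exp_runSum_le_one {n : ℕ} {p : Rule n} (hq : ∀ h k, 0 ≤ mix p h k)
    {f : List (Fin n) → Fin n → ℝ} (T : ℕ)
    (hf : ∀ h, h.length < T → ∑ k, mix p h k * Real.exp (f h k) ≤ 1) :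
    expect p T (fun h => Real.exp (runSum f h)) ≤ 1 := by
  induction T with
  | zero => simp [expect_zero, runSum]
  | succ T ih =>
    rw [expect_succ]
    refine (expect_mono hq fun h hh => ?_).trans (ih fun h hh => hf h (hh.trans T.lt_succ_self))
    have : ∑ k, mix p h k * Real.exp (runSum f (k :: h)) =
        Real.exp (runSum f h) * ∑ k, mix p h k * Real.exp (f h k) := by
      rw [Finset.mul_sum]
      refine Finset.sum_congr rfl fun k _ => ?_
      rw [runSum, Real.exp_add]
      ring
    rw [this]
    exact mul_le_of_le_one_right (Real.exp_pos _).le (hf h (hh ▸ T.lt_succ_self))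

/-- Markov's inequality: an event that contains `{Z ≤ c / δ}` has probability at least `1 - δ` if
`Z ≥ 0` has expectation at most `c`. -/
theorem one_sub_le_prob {n T : ℕ} {p : Rule n} (hq : ∀ h k, 0 ≤ mix p h k)
    (hq₁ : ∀ h, ∑ k, mix p h k = 1) {Z : List (Fin n) → ℝ} {c δ : ℝ} (hc : 0 < c) (hδ : 0 < δ)
    (hZ₀ : ∀ h, 0 ≤ Z h) (hZ : expect p T Z ≤ c) {E : List (Fin n) → Prop}
    (hE : ∀ h, h.length = T → Z h ≤ c / δ → E h) :
    1 - δ ≤ prob p T E := by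
  classical
  have hprob : prob p T E = expect p T (fun h => if E h then 1 else 0) := by
    simp [prob, expect]
  have hle : expect p T (fun _ => 1) ≤
      expect p T (fun h => (if E h then 1 else 0) + δ / c * Z h) := by
    refine expect_mono hq fun h hh => ?_
    by_cases hEh : E h
    · simpa [hEh] using mul_nonneg (div_nonneg hδ.le hc.le) (hZ₀ h)
    · have hlt : c / δ < Z h := lt_of_not_ge fun hle => hEh (hE h hh hle)
      rw [div_lt_iff₀ hδ] at hlt
      simp only [hEh, if_false, zero_add]
      rw [div_mul_eq_mul_div, le_div_iff₀ hc]
      linarith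
  rw [expect_one hq₁, expect_add, expect_const_mul, ← hprob] at hle
  have : δ / c * expect p T Z ≤ δ :=
    (mul_le_mul_of_nonneg_left hZ (div_nonneg hδ.le hc.le)).trans_eq (div_mul_cancel₀ δ hc.ne')
  linarith

/-! ### Elementary inequalities -/

/-- Invert `1 + x + x² / 2 ≤ exp x`, using `(1 - x + x² / 2) (1 + x + x² / 2) = 1 + x⁴ / 4 ≥ 1`. -/
theorem exp_neg_le_quadratic {x : ℝ} (hx : 0 ≤ x) : Real.exp (-x) ≤ 1 - x + x ^ 2 / 2 := by
  have h := Real.quadratic_le_exp_of_nonneg hx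
  rw [Real.exp_neg]
  refine inv_le_of_inv_le₀ (by nlinarith [sq_nonneg (x - 1)]) (le_trans ?_ h)
  rw [inv_le_iff_one_le_mul₀ (by nlinarith [sq_nonneg (x - 1)])]
  nlinarith [sq_nonneg (x ^ 2)]

theorem exp_le_one_add_two_mul {x : ℝ} (h₀ : 0 ≤ x) (h₁ : x ≤ 1) : Real.exp x ≤ 1 + 2 * x := by
  have := (abs_le.1 (Real.abs_exp_sub_one_sub_id_le (abs_le.2 ⟨by linarith, h₁⟩))).2
  nlinarith

/-- Summed over coordinates this is nonnegativity of relative entropy. It is kept pointwise because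
the second argument need not be normalized, which the stability estimate exploits. -/
theorem sub_le_mul_log_sub_log {x y : ℝ} (hx : 0 ≤ x) (hy : 0 < y) :
    x - y ≤ x * (Real.log x - Real.log y) := by
  rcases hx.eq_or_lt with rfl | hx
  · simpa using hy.le
  · have h := Real.log_le_sub_one_of_pos (div_pos hy hx)
    rw [Real.log_div hy.ne' hx.ne'] at h
    have := mul_le_mul_of_nonneg_left h hx.le
    rw [mul_sub, mul_sub, mul_div_cancel₀ _ hx.ne'] at this
    linarith

theorem sub_lt_mul_log_sub_log {x y : ℝ} (hx : 0 ≤ x) (hy : 0 < y) (hxy : x ≠ y) :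
    x - y < x * (Real.log x - Real.log y) := by
  rcases hx.eq_or_lt with rfl | hx
  · simpa using hy
  · have h := Real.log_lt_sub_one_of_pos (div_pos hy hx)
      (fun h => hxy ((div_eq_one_iff_eq hx.ne').1 h).symm)
    rw [Real.log_div hy.ne' hx.ne'] at h
    have := mul_lt_mul_of_pos_left h hx
    rw [mul_sub, mul_sub, mul_div_cancel₀ _ hx.ne'] at this
    linarith

/-- The exponential moment of an importance weighted estimate with implicit exploration. -/
theorem implicit_exploration_exp_le {q γ z : ℝ} (hq : 0 < q) (hz : 0 ≤ z) (hzγ : z ≤ 2 * γ) :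
    1 - q + q * Real.exp (z / (q + γ)) ≤ Real.exp z := by
  have hlog := Real.le_log_one_add_of_nonneg (div_nonneg hz hq.le)
  -- `log (1 + x) ≥ 2 x / (x + 2)` at `x = z / q` gives `z / (q + z / 2)`, and `γ ≥ z / 2` only
  -- enlarges the denominator. This is where the factor `1 / 2` in the implicit rate comes from.
  have hle : z / (q + γ) ≤ Real.log (1 + z / q) := by
    refine le_trans ?_ hlog
    have : 2 * (z / q) / (z / q + 2) = z / (q + z / 2) := by
      field_simp
      ring
    rw [this]
    exact div_le_div_of_nonneg_left hz (by positivity) (by linarith)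
  have hpos : 0 < 1 + z / q := by positivity
  have hexp := (Real.le_log_iff_exp_le hpos).1 hle
  calc 1 - q + q * Real.exp (z / (q + γ)) ≤ 1 - q + q * (1 + z / q) := by gcongr
    _ = z + 1 := by field_simp; ring
    _ ≤ Real.exp z := Real.add_one_le_exp z

/-! ### The entropy regularizer -/

theorem shannon_nonneg {n : ℕ} (hn : 0 < n) {x : Fin n → ℝ} (hx : x ∈ stdSimplex ℝ (Fin n)) :
    0 ≤ shannon x := by
  have hn' : (0 : ℝ) < n := Nat.cast_pos.2 hn
  have h : ∑ i, (x i - (n : ℝ)⁻¹) ≤ ∑ i, x i * (Real.log (x i) - Real.log (n : ℝ)⁻¹) :=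
    Finset.sum_le_sum fun i _ => sub_le_mul_log_sub_log (hx.1 i) (inv_pos.2 hn')
  simp only [Real.log_inv, sub_neg_eq_add, mul_add, Finset.sum_add_distrib, Finset.sum_sub_distrib,
    ← Finset.sum_mul, hx.2, Finset.sum_const, Finset.card_univ, Fintype.card_fin, nsmul_eq_mul,
    mul_inv_cancel₀ hn'.ne', one_mul, sub_self] at h
  unfold shannon
  linarith

theorem shannon_single {n : ℕ} (i : Fin n) : shannon (Pi.single i (1 : ℝ)) = Real.log n := by
  have : ∀ j, (Pi.single i (1 : ℝ) : Fin n → ℝ) j * Real.log ((Pi.single i (1 : ℝ) : Fin n → ℝ) j)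
      = 0 := by
    intro j
    by_cases hj : j = i
    · subst hj; simp
    · simp [hj]
  simp [shannon, this]

/-- The softmax weights. -/
noncomputable def softmax {n : ℕ} (r : ℝ) (L : Fin n → ℝ) (i : Fin n) : ℝ :=
  Real.exp (-(L i / r)) / ∑ j, Real.exp (-(L j / r))

theorem sum_exp_pos {n : ℕ} (hn : 0 < n) (f : Fin n → ℝ) : 0 < ∑ j, Real.exp (f j) :=
  Finset.sum_pos (fun _ _ => Real.exp_pos _) ⟨⟨0, hn⟩, Finset.mem_univ _⟩

theorem softmax_pos {n : ℕ} (hn : 0 < n) (r : ℝ) (L : Fin n → ℝ) (i : Fin n) :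
    0 < softmax r L i :=
  div_pos (Real.exp_pos _) (sum_exp_pos hn _)

theorem softmax_mem_stdSimplex {n : ℕ} (hn : 0 < n) (r : ℝ) (L : Fin n → ℝ) :
    softmax r L ∈ stdSimplex ℝ (Fin n) := by
  refine ⟨fun i => (softmax_pos hn r L i).le, ?_⟩
  unfold softmax
  rw [← Finset.sum_div, div_self (sum_exp_pos hn _).ne']

/-- The Gibbs variational identity. -/
theorem linear_add_mul_shannon_eq {n : ℕ} (hn : 0 < n) {r : ℝ} (hr : 0 < r) (L : Fin n → ℝ)
    {x : Fin n → ℝ} (hx : x ∈ stdSimplex ℝ (Fin n)) :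
    ∑ i, L i * x i + r * shannon x =
      r * (Real.log n - Real.log (∑ j, Real.exp (-(L j / r)))) +
        r * ∑ i, x i * (Real.log (x i) - Real.log (softmax r L i)) := by
  have hlog : ∀ i, Real.log (softmax r L i) =
      -(L i / r) - Real.log (∑ j, Real.exp (-(L j / r))) := fun i => by
    unfold softmax
    rw [Real.log_div (Real.exp_pos _).ne' (sum_exp_pos hn _).ne', Real.log_exp]
  have hterm : ∀ i, x i * (Real.log (x i) - Real.log (softmax r L i)) =
      x i * Real.log (x i) + L i * x i / r + x i * Real.log (∑ j, Real.exp (-(L j / r))) :=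
    fun i => by rw [hlog]; ring
  simp only [hterm, Finset.sum_add_distrib, ← Finset.sum_mul, ← Finset.sum_div, hx.2, shannon]
  field_simp
  ring

/-- By the Gibbs identity the objective is a constant plus `r` times the relative entropy to the
softmax weights, which is strictly positive elsewhere on the simplex. -/
theorem eq_softmax_of_isMinOn {n : ℕ} (hn : 0 < n) {r : ℝ} (hr : 0 < r) {L x : Fin n → ℝ}
    (hx : x ∈ stdSimplex ℝ (Fin n))
    (hmin : IsMinOn (fun x => ∑ i, L i * x i + r * shannon x) (stdSimplex ℝ (Fin n)) x) :
    x = softmax r L := by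
  have hg := softmax_mem_stdSimplex hn r L
  have hle := isMinOn_iff.1 hmin _ hg
  simp only [linear_add_mul_shannon_eq hn hr L hx, linear_add_mul_shannon_eq hn hr L hg, sub_self,
    mul_zero, Finset.sum_const_zero, add_zero] at hle
  by_contra hne
  obtain ⟨i, hi⟩ := Function.ne_iff.1 hne
  have hlt : ∑ i, (x i - softmax r L i) <
      ∑ i, x i * (Real.log (x i) - Real.log (softmax r L i)) :=
    Finset.sum_lt_sum (fun j _ => sub_le_mul_log_sub_log (hx.1 j) (softmax_pos hn r L j))
      ⟨i, Finset.mem_univ i, sub_lt_mul_log_sub_log (hx.1 i) (softmax_pos hn r L i) hi⟩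
  rw [Finset.sum_sub_distrib, hx.2, hg.2, sub_self] at hlt
  nlinarith

/-- Stability of the entropically regularized minimum under a nonnegative loss. -/
theorem entropic_stability {n : ℕ} (hn : 0 < n) {r : ℝ} (hr : 0 < r) {L v x y : Fin n → ℝ}
    (hv : ∀ i, 0 ≤ v i) (hx : x ∈ stdSimplex ℝ (Fin n))
    (hmin : IsMinOn (fun x => ∑ i, L i * x i + r * shannon x) (stdSimplex ℝ (Fin n)) x)
    (hy : y ∈ stdSimplex ℝ (Fin n)) :
    ∑ i, L i * x i + r * shannon x + (∑ i, x i * v i - r⁻¹ / 2 * ∑ i, x i * v i ^ 2) ≤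
      ∑ i, (L i + v i) * y i + r * shannon y := by
  obtain rfl := eq_softmax_of_isMinOn hn hr hx hmin
  set g := softmax r L with hgdef
  have hsplit : ∑ i, (L i + v i) * y i + r * shannon y =
      (∑ i, L i * y i + r * shannon y) + ∑ i, v i * y i := by
    simp only [add_mul, Finset.sum_add_distrib]
    ring
  rw [hsplit, linear_add_mul_shannon_eq hn hr L hx, linear_add_mul_shannon_eq hn hr L hy]
  simp only [← hgdef, sub_self, mul_zero, Finset.sum_const_zero, add_zero]
  -- Compare `y` with the unnormalized weights `g i * exp (-(v i / r))`, so that no new partition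
  -- function appears. The quadratic bound on the exponential needs `v i ≥ 0`, which is why the
  -- losses are shifted.
  have hterm : ∀ i, y i - g i * (1 - v i / r + (v i / r) ^ 2 / 2) ≤
      y i * (Real.log (y i) - Real.log (g i)) + v i * y i / r := fun i => by
    have hgi := softmax_pos hn r L i
    have h := sub_le_mul_log_sub_log (hy.1 i) (mul_pos hgi (Real.exp_pos (-(v i / r))))
    rw [← hgdef, Real.log_mul hgi.ne' (Real.exp_pos _).ne', Real.log_exp] at h
    have h' := mul_le_mul_of_nonneg_left (exp_neg_le_quadratic (div_nonneg (hv i) hr.le)) hgi.le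
    rw [← hgdef] at h'
    have : v i * y i / r = y i * (v i / r) := by ring
    rw [this]
    linarith
  have hsum := Finset.sum_le_sum fun i (_ : i ∈ Finset.univ) => hterm i
  have hleft : ∑ i, (y i - g i * (1 - v i / r + (v i / r) ^ 2 / 2)) =
      (∑ i, g i * v i) / r - (∑ i, g i * v i ^ 2) / (2 * r ^ 2) := by
    have : ∀ i, y i - g i * (1 - v i / r + (v i / r) ^ 2 / 2) =
        y i - g i + g i * v i / r - g i * v i ^ 2 / (2 * r ^ 2) := fun i => by
      field_simp
      ring
    simp only [this, Finset.sum_add_distrib, Finset.sum_sub_distrib, ← Finset.sum_div, hx.2, hy.2]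
    ring
  rw [hleft, Finset.sum_add_distrib, ← Finset.sum_div] at hsum
  have hmul := mul_le_mul_of_nonneg_left hsum hr.le
  have e1 : r * ((∑ i, g i * v i) / r - (∑ i, g i * v i ^ 2) / (2 * r ^ 2)) =
      ∑ i, g i * v i - r⁻¹ / 2 * ∑ i, g i * v i ^ 2 := by
    field_simp
  rw [e1, mul_add, mul_div_cancel₀ _ hr.ne'] at hmul
  linarith

/-! ### Rates -/

section Rates

variable {n : ℕ}

theorem log_natCast_pos (hn : 2 ≤ n) : 0 < Real.log n :=
  Real.log_pos (by exact_mod_cast (by omega : 1 < n))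

theorem mul_log_pos (hn : 2 ≤ n) : 0 < (n : ℝ) * Real.log n :=
  mul_pos (by exact_mod_cast (by omega : 0 < n)) (log_natCast_pos hn)

theorem explorationRate_pos (hn : 2 ≤ n) (t : ℕ) : 0 < explorationRate n t := by
  have := mul_log_pos hn
  exact Real.sqrt_pos.2 (by positivity)

theorem explorationRate_le_one (hn : 2 ≤ n) (t : ℕ) : explorationRate n t ≤ 1 := by
  have := mul_log_pos hn
  refine Real.sqrt_le_one.2 (div_le_one_of_le₀ ?_ (by positivity))
  linarith [(Nat.cast_nonneg t : (0 : ℝ) ≤ t)]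

theorem explorationRate_anti (hn : 2 ≤ n) {s t : ℕ} (hst : s ≤ t) :
    explorationRate n t ≤ explorationRate n s := by
  have := mul_log_pos hn
  have : (s : ℝ) ≤ t := Nat.cast_le.2 hst
  exact Real.sqrt_le_sqrt (div_le_div_of_nonneg_left (by positivity) (by positivity) (by linarith))

/-- The average cost `√(n log n / t)` of round `t`, up to the scale of the losses. -/
noncomputable def roundCost (n t : ℕ) : ℝ := √((n : ℝ) * Real.log n / t)

theorem roundCost_nonneg (n t : ℕ) : 0 ≤ roundCost n t := Real.sqrt_nonneg _

theorem explorationRate_le_roundCost (hn : 2 ≤ n) {t : ℕ} (ht : 0 < t) :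
    explorationRate n t ≤ roundCost n t := by
  have := mul_log_pos hn
  have : (0 : ℝ) < t := Nat.cast_pos.2 ht
  exact Real.sqrt_le_sqrt (div_le_div_of_nonneg_left (by positivity) (by positivity) (by linarith))

theorem mul_sqrt_eq_roundCost (n t : ℕ) :
    n * √(Real.log n / ((n : ℝ) * t)) = roundCost n t := by
  rcases n.eq_zero_or_pos with rfl | hn
  · simp [roundCost]
  have hn' : (0 : ℝ) < n := Nat.cast_pos.2 hn
  have h : (n : ℝ) = √((n : ℝ) ^ 2) := (Real.sqrt_sq hn'.le).symm
  conv_lhs => rw [h, ← Real.sqrt_mul (sq_nonneg _)]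
  unfold roundCost
  rw [Real.sqrt_sq hn'.le]
  congr 1
  rcases t.eq_zero_or_pos with rfl | ht
  · simp
  field_simp

theorem div_sqrt_eq_roundCost (n t : ℕ) :
    n / √((n : ℝ) * t / Real.log n) = roundCost n t := by
  rw [← mul_sqrt_eq_roundCost, div_eq_mul_inv, ← Real.sqrt_inv, inv_div]

theorem sum_inv_sqrt_le (T : ℕ) :
    ∑ t ∈ Finset.range T, 1 / √((t : ℝ) + 1) ≤ 2 * √(T : ℝ) := by
  induction T with
  | zero => simp
  | succ T ih =>
    rw [Finset.sum_range_succ]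
    have h₁ : 0 < √((T : ℝ) + 1) := Real.sqrt_pos.2 (by positivity)
    have h₂ := Real.sqrt_nonneg (T : ℝ)
    have h₃ := Real.sq_sqrt (by positivity : (0 : ℝ) ≤ (T : ℝ) + 1)
    have h₄ := Real.sq_sqrt (by positivity : (0 : ℝ) ≤ (T : ℝ))
    have : 1 / √((T : ℝ) + 1) ≤ 2 * √((T : ℝ) + 1) - 2 * √(T : ℝ) := by
      rw [div_le_iff₀ h₁]
      nlinarith [sq_nonneg (√((T : ℝ) + 1) - √(T : ℝ))]
    push_cast
    linarith

theorem runSum_round {g : ℕ → ℝ} (h : List (Fin n)) :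
    runSum (fun h _ => g (round h)) h = ∑ t ∈ Finset.range h.length, g (t + 1) := by
  induction h with
  | nil => rfl
  | cons k h ih => rw [runSum, ih, List.length_cons, Finset.sum_range_succ, round]

theorem runSum_roundCost_le (h : List (Fin n)) :
    runSum (fun h _ => roundCost n (round h)) h ≤ 2 * √((n : ℝ) * h.length * Real.log n) := by
  rw [runSum_round (g := roundCost n)]
  have hnl : 0 ≤ (n : ℝ) * Real.log n := mul_nonneg n.cast_nonneg (Real.log_natCast_nonneg n)
  have : ∀ t : ℕ, roundCost n (t + 1) = √((n : ℝ) * Real.log n) * (1 / √((t : ℝ) + 1)) := fun t => by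
    rw [roundCost, Real.sqrt_div hnl]
    push_cast
    ring
  simp only [this, ← Finset.mul_sum]
  have e : (n : ℝ) * h.length * Real.log n = (n * Real.log n) * h.length := by ring
  rw [e, Real.sqrt_mul hnl]
  nlinarith [sum_inv_sqrt_le h.length, Real.sqrt_nonneg ((n : ℝ) * Real.log n)]

end Rates

/-! ### One round of the algorithm -/

section Round

variable {n : ℕ} {ℓ : Adversary n} {p : Rule n}

theorem abs_clip_le {C : ℝ} (hC : 0 ≤ C) (x : ℝ) : |clip C x| ≤ C := by
  unfold clip
  exact abs_le.2 ⟨le_max_left _ _, max_le (by linarith) (min_le_left _ _)⟩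

theorem abs_clip_sub_le {C : ℝ} (hC : 0 ≤ C) (x : ℝ) : |clip C x - x| ≤ max (|x| - C) 0 := by
  unfold clip
  rcases le_total x (-C) with h | h
  · rw [min_eq_right (by linarith), max_eq_left h, abs_of_nonpos (by linarith : x ≤ 0)]
    exact (abs_of_nonneg (by linarith)).trans_le (le_max_of_le_left (by linarith))
  · rcases le_total x C with h' | h'
    · rw [min_eq_right h', max_eq_right h, sub_self, abs_zero]
      exact le_max_right _ _
    · rw [min_eq_left h', max_eq_right (by linarith), abs_of_nonneg (by linarith : 0 ≤ x)]
      exact (abs_of_nonpos (by linarith)).trans_le (le_max_of_le_left (by linarith))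

/-- The amount by which a loss exceeds the clipping threshold. -/
noncomputable def excess (ℓ : Adversary n) (h : List (Fin n)) (i : Fin n) : ℝ :=
  max (|ℓ h i| - threshold ℓ h) 0

/-- The clipped loss, shifted to be nonnegative. -/
noncomputable def shiftedLoss (ℓ : Adversary n) (h : List (Fin n)) (i : Fin n) : ℝ :=
  clip (threshold ℓ h) (ℓ h i) + threshold ℓ h

theorem threshold_nonneg (ℓ : Adversary n) : ∀ h, 0 ≤ threshold ℓ h
  | [] => le_rfl
  | k :: h => by
    unfold threshold
    have := threshold_nonneg ℓ h
    split_ifs <;> positivity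

/-- The threshold serves as a potential for the clipping errors of the played actions: their sum
telescopes. -/
theorem threshold_add_excess_le (ℓ : Adversary n) (h : List (Fin n)) (k : Fin n) :
    threshold ℓ h + excess ℓ h k ≤ threshold ℓ (k :: h) := by
  have := threshold_nonneg ℓ h
  rw [threshold, excess]
  split_ifs with hlt
  · rw [max_eq_left (by linarith)]
    linarith [abs_nonneg (ℓ h k)]
  · rw [max_eq_right (by linarith)]
    linarith

theorem excess_nonneg (ℓ : Adversary n) (h : List (Fin n)) (i : Fin n) : 0 ≤ excess ℓ h i :=
  le_max_right _ _

theorem threshold_le_cons (ℓ : Adversary n) (h : List (Fin n)) (k : Fin n) :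
    threshold ℓ h ≤ threshold ℓ (k :: h) := by
  linarith [threshold_add_excess_le ℓ h k, excess_nonneg ℓ h k]

theorem runSum_excess_le (ℓ : Adversary n) (h : List (Fin n)) :
    runSum (excess ℓ) h ≤ threshold ℓ h :=
  runSum_le_of_increment le_rfl (fun h k _ => threshold_add_excess_le ℓ h k) h le_rfl

theorem threshold_le {T : ℕ} {M : ℝ} (hM₀ : 0 ≤ M) (hM : ∀ h i, h.length < T → |ℓ h i| ≤ M) :
    ∀ h : List (Fin n), h.length ≤ T → threshold ℓ h ≤ 2 * M
  | [], _ => by simpa [threshold] using hM₀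
  | k :: h, hT => by
    have hT' : h.length < T := by simpa using hT
    have := threshold_le hM₀ hM h hT'.le
    have := hM h k hT'
    rw [threshold]
    split_ifs <;> linarith

theorem shiftedLoss_nonneg (ℓ : Adversary n) (h : List (Fin n)) (i : Fin n) :
    0 ≤ shiftedLoss ℓ h i := by
  have := (abs_le.1 (abs_clip_le (threshold_nonneg ℓ h) (ℓ h i))).1
  unfold shiftedLoss
  linarith

theorem shiftedLoss_le (ℓ : Adversary n) (h : List (Fin n)) (i : Fin n) :
    shiftedLoss ℓ h i ≤ 2 * threshold ℓ h := by
  have := (abs_le.1 (abs_clip_le (threshold_nonneg ℓ h) (ℓ h i))).2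
  unfold shiftedLoss
  linarith

theorem abs_shiftedLoss_sub_le (ℓ : Adversary n) (h : List (Fin n)) (i : Fin n) :
    |shiftedLoss ℓ h i - threshold ℓ h - ℓ h i| ≤ excess ℓ h i := by
  rw [shiftedLoss, add_sub_cancel_right]
  exact abs_clip_sub_le (threshold_nonneg ℓ h) _

theorem implicitRate_nonneg (ℓ : Adversary n) (h : List (Fin n)) : 0 ≤ implicitRate ℓ h := by
  unfold implicitRate
  split_ifs <;> positivity

theorem sum_mix (hn : 2 ≤ n) (hp : IsSCBIX ℓ p) (h : List (Fin n)) : ∑ k, mix p h k = 1 := by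
  have hn' : (n : ℝ) ≠ 0 := by positivity
  unfold mix
  rw [Finset.sum_add_distrib, ← Finset.mul_sum, (hp h).1.2]
  simp only [Finset.sum_const, Finset.card_univ, Fintype.card_fin, nsmul_eq_mul]
  field_simp
  ring

theorem explorationRate_div_le_mix (hn : 2 ≤ n) (hp : IsSCBIX ℓ p) (h : List (Fin n)) (k : Fin n) :
    explorationRate n (round h) / n ≤ mix p h k := by
  have := explorationRate_le_one hn (round h)
  have := mul_nonneg (sub_nonneg.2 this) ((hp h).1.1 k)
  unfold mix
  linarith

theorem mix_pos (hn : 2 ≤ n) (hp : IsSCBIX ℓ p) (h : List (Fin n)) (k : Fin n) :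
    0 < mix p h k :=
  (div_pos (explorationRate_pos hn _) (by positivity)).trans_le
    (explorationRate_div_le_mix hn hp h k)

/-- Whether exploration or exploitation dominates, the weights `p / q` are at most `2 n` in sum. -/
theorem sum_div_mix_le (hn : 2 ≤ n) (hp : IsSCBIX ℓ p) (h : List (Fin n)) :
    ∑ k, p h k / mix p h k ≤ 2 * n := by
  have hn' : (0 : ℝ) < n := by positivity
  have hp₀ := (hp h).1.1
  have hβ₁ := explorationRate_le_one hn (round h)
  rcases le_total (1 / 2) (explorationRate n (round h)) with hβ | hβ
  · have : ∀ k, p h k / mix p h k ≤ 2 * n * p h k := fun k => by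
      rw [div_le_iff₀ (mix_pos hn hp h k)]
      have : 1 / 2 / (n : ℝ) ≤ mix p h k :=
        (div_le_div_of_nonneg_right hβ hn'.le).trans (explorationRate_div_le_mix hn hp h k)
      rw [div_le_iff₀ hn'] at this
      nlinarith [hp₀ k]
    refine (Finset.sum_le_sum fun k _ => this k).trans ?_
    rw [← Finset.mul_sum, (hp h).1.2, mul_one]
  · have : ∀ k, p h k / mix p h k ≤ 2 := fun k => by
      rw [div_le_iff₀ (mix_pos hn hp h k)]
      have : 0 ≤ explorationRate n (round h) / n :=
        div_nonneg (explorationRate_pos hn _).le hn'.le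
      unfold mix
      nlinarith [hp₀ k]
    refine (Finset.sum_le_sum fun k _ => this k).trans ?_
    simp [mul_comm]

theorem div_mix_le (hn : 2 ≤ n) (hp : IsSCBIX ℓ p) (h : List (Fin n)) (k : Fin n) :
    p h k / mix p h k ≤ 2 * n :=
  (Finset.single_le_sum (fun i _ => div_nonneg ((hp h).1.1 i) (mix_pos hn hp h i).le)
    (Finset.mem_univ k)).trans (sum_div_mix_le hn hp h)

/-- The loss estimate of the action that is played. -/
noncomputable def playedEstimate (ℓ : Adversary n) (p : Rule n) (h : List (Fin n)) (k : Fin n) : ℝ :=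
  shiftedLoss ℓ h k / (mix p h k + implicitRate ℓ h)

theorem lossEstimate_eq (ℓ : Adversary n) (p : Rule n) (h : List (Fin n)) (k i : Fin n) :
    lossEstimate ℓ p h k i = if i = k then playedEstimate ℓ p h i else 0 := rfl

theorem playedEstimate_nonneg (hn : 2 ≤ n) (hp : IsSCBIX ℓ p) (h : List (Fin n)) (k : Fin n) :
    0 ≤ playedEstimate ℓ p h k :=
  div_nonneg (shiftedLoss_nonneg ℓ h k)
    (add_nonneg (mix_pos hn hp h k).le (implicitRate_nonneg ℓ h))

theorem playedEstimate_le (hn : 2 ≤ n) (hp : IsSCBIX ℓ p) (h : List (Fin n)) (k : Fin n) :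
    playedEstimate ℓ p h k ≤ 2 * threshold ℓ h / mix p h k :=
  div_le_div₀ (mul_nonneg zero_le_two (threshold_nonneg ℓ h)) (shiftedLoss_le ℓ h k)
    (mix_pos hn hp h k) (by linarith [implicitRate_nonneg ℓ h])

theorem mul_playedEstimate (hn : 2 ≤ n) (hp : IsSCBIX ℓ p) (h : List (Fin n)) (k : Fin n) :
    (mix p h k + implicitRate ℓ h) * playedEstimate ℓ p h k = shiftedLoss ℓ h k :=
  mul_div_cancel₀ _ (add_pos_of_pos_of_nonneg (mix_pos hn hp h k) (implicitRate_nonneg ℓ h)).ne'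

theorem mix_mul_playedEstimate_le (hn : 2 ≤ n) (hp : IsSCBIX ℓ p) (h : List (Fin n)) (k : Fin n) :
    mix p h k * playedEstimate ℓ p h k ≤ 2 * threshold ℓ h := by
  have h₁ := mul_playedEstimate hn hp h k
  have h₂ := mul_nonneg (implicitRate_nonneg ℓ h) (playedEstimate_nonneg hn hp h k)
  linarith [shiftedLoss_le ℓ h k]

/-- The stability term of the regularized leader. -/
noncomputable def stability (ℓ : Adversary n) (p : Rule n) (h : List (Fin n)) (k : Fin n) : ℝ :=
  min (p h k * playedEstimate ℓ p h k)
    ((invLearningRate ℓ h)⁻¹ / 2 * (p h k * playedEstimate ℓ p h k ^ 2))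

/-- The cost of a round: the stability term and the bias of forced and implicit exploration. -/
noncomputable def overhead (ℓ : Adversary n) (p : Rule n) (h : List (Fin n)) (k : Fin n) : ℝ :=
  stability ℓ p h k +
    (explorationRate n (round h) / n + implicitRate ℓ h) * playedEstimate ℓ p h k

/-- The shifted loss is `q + γ` times its estimate; expand `q = (1 - β) p + β / n` and drop `-β p`.
The stability term is subtracted and added back, so that the bracket is exactly what the regularized
leader controls. -/
theorem shiftedLoss_le_add_overhead (hn : 2 ≤ n) (hp : IsSCBIX ℓ p) (h : List (Fin n))
    (k : Fin n) :
    shiftedLoss ℓ h k ≤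
      (p h k * playedEstimate ℓ p h k - stability ℓ p h k) + overhead ℓ p h k := by
  have h₁ := mul_playedEstimate hn hp h k
  have h₂ := mul_nonneg (mul_nonneg (explorationRate_pos hn (round h)).le ((hp h).1.1 k))
    (playedEstimate_nonneg hn hp h k)
  unfold overhead
  rw [← h₁, mix]
  linarith

theorem invLearningRate_nonneg (ℓ : Adversary n) (h : List (Fin n)) : 0 ≤ invLearningRate ℓ h :=
  mul_nonneg (threshold_nonneg ℓ h) (Real.sqrt_nonneg _)

theorem invLearningRate_le_cons (ℓ : Adversary n) (h : List (Fin n)) (k : Fin n) :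
    invLearningRate ℓ h ≤ invLearningRate ℓ (k :: h) := by
  refine mul_le_mul (threshold_le_cons ℓ h k) (Real.sqrt_le_sqrt ?_) (Real.sqrt_nonneg _)
    (threshold_nonneg ℓ _)
  refine div_le_div_of_nonneg_right (mul_le_mul_of_nonneg_left ?_ n.cast_nonneg)
    (Real.log_natCast_nonneg n)
  simp [round]

theorem stability_nonneg (hn : 2 ≤ n) (hp : IsSCBIX ℓ p) (h : List (Fin n)) (k : Fin n) :
    0 ≤ stability ℓ p h k := by
  have h₁ := playedEstimate_nonneg hn hp h k
  have h₂ := (hp h).1.1 k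
  have h₃ := invLearningRate_nonneg ℓ h
  exact le_min (by positivity) (by positivity)

theorem overhead_nonneg (hn : 2 ≤ n) (hp : IsSCBIX ℓ p) (h : List (Fin n)) (k : Fin n) :
    0 ≤ overhead ℓ p h k := by
  have h₁ := playedEstimate_nonneg hn hp h k
  have h₂ := stability_nonneg hn hp h k
  have h₃ := implicitRate_nonneg ℓ h
  have h₄ := explorationRate_pos hn (round h)
  unfold overhead
  positivity

/-- The range needed for the exponential moment. It uses the first argument of the minimum in
`stability`; the bound on the conditional mean uses the second. -/
theorem overhead_le (hn : 2 ≤ n) (hp : IsSCBIX ℓ p) (h : List (Fin n)) (k : Fin n) :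
    overhead ℓ p h k ≤ 6 * n * threshold ℓ h := by
  have hC := threshold_nonneg ℓ h
  have h₁ : stability ℓ p h k ≤ 4 * n * threshold ℓ h := calc
    stability ℓ p h k ≤ p h k * playedEstimate ℓ p h k := min_le_left _ _
    _ ≤ p h k * (2 * threshold ℓ h / mix p h k) :=
      mul_le_mul_of_nonneg_left (playedEstimate_le hn hp h k) ((hp h).1.1 k)
    _ = p h k / mix p h k * (2 * threshold ℓ h) := by ring
    _ ≤ 2 * n * (2 * threshold ℓ h) :=
      mul_le_mul_of_nonneg_right (div_mix_le hn hp h k) (by positivity)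
    _ = _ := by ring
  have h₂ : (explorationRate n (round h) / n + implicitRate ℓ h) * playedEstimate ℓ p h k ≤
      2 * threshold ℓ h := by
    refine le_trans (mul_le_mul_of_nonneg_right ?_ (playedEstimate_nonneg hn hp h k))
      ((mul_playedEstimate hn hp h k).trans_le (shiftedLoss_le ℓ h k))
    linarith [explorationRate_div_le_mix hn hp h k]
  have : (2 : ℝ) ≤ n := by exact_mod_cast hn
  unfold overhead
  nlinarith

theorem nat_mul_implicitRate_le (ℓ : Adversary n) (h : List (Fin n)) :
    n * implicitRate ℓ h ≤ roundCost n (round h) / 2 := by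
  unfold implicitRate
  split_ifs
  · rw [mul_zero]
    exact div_nonneg (roundCost_nonneg _ _) zero_le_two
  · rw [← mul_sqrt_eq_roundCost, mul_div_assoc]

theorem sum_mix_mul_stability_le (hn : 2 ≤ n) (hp : IsSCBIX ℓ p) (h : List (Fin n)) :
    ∑ k, mix p h k * stability ℓ p h k ≤ 4 * threshold ℓ h * roundCost n (round h) := by
  set C := threshold ℓ h with hC
  have hC₀ : 0 ≤ C := threshold_nonneg ℓ h
  have hinv := invLearningRate_nonneg ℓ h
  have hterm : ∀ k, mix p h k * stability ℓ p h k ≤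
      (invLearningRate ℓ h)⁻¹ * (2 * C ^ 2) * (p h k / mix p h k) := fun k => by
    have hq := mix_pos hn hp h k
    have hv := playedEstimate_nonneg hn hp h k
    have hqv := mix_mul_playedEstimate_le hn hp h k
    have hsq : (mix p h k * playedEstimate ℓ p h k) ^ 2 ≤ (2 * C) ^ 2 := by
      gcongr
    have hpk := (hp h).1.1 k
    calc mix p h k * stability ℓ p h k
        ≤ mix p h k * ((invLearningRate ℓ h)⁻¹ / 2 * (p h k * playedEstimate ℓ p h k ^ 2)) :=
          -- One factor `q` comes from the expectation; completing the square to `(q v)² ≤ (2 C)²`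
          -- leaves `p / q`, whose sum is at most `2 n`.
          mul_le_mul_of_nonneg_left (min_le_right _ _) hq.le
      _ = (invLearningRate ℓ h)⁻¹ / 2 * (p h k / mix p h k) *
            (mix p h k * playedEstimate ℓ p h k) ^ 2 := by field_simp
      _ ≤ (invLearningRate ℓ h)⁻¹ / 2 * (p h k / mix p h k) * (2 * C) ^ 2 := by gcongr
      _ = _ := by ring
  refine (Finset.sum_le_sum fun k _ => hterm k).trans ?_
  rw [← Finset.mul_sum]
  refine (mul_le_mul_of_nonneg_left (sum_div_mix_le hn hp h) (by positivity)).trans ?_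
  rw [invLearningRate, ← div_sqrt_eq_roundCost, ← hC]
  rcases hC₀.eq_or_lt with h0 | hpos
  · simp [← h0]
  · refine le_of_eq ?_
    have : 0 < √((n : ℝ) * (round h : ℝ) / Real.log n) := by
      have := log_natCast_pos hn
      have : 0 < (round h : ℝ) := by simp [round]; positivity
      exact Real.sqrt_pos.2 (by positivity)
    field_simp
    norm_num

theorem sum_mix_mul_overhead_le (hn : 2 ≤ n) (hp : IsSCBIX ℓ p) (h : List (Fin n)) :
    ∑ k, mix p h k * overhead ℓ p h k ≤ 7 * threshold ℓ h * roundCost n (round h) := by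
  have hn' : (0 : ℝ) < n := by positivity
  have hC := threshold_nonneg ℓ h
  have h₁ := sum_mix_mul_stability_le hn hp h
  have h₂ : ∑ k, mix p h k *
      ((explorationRate n (round h) / n + implicitRate ℓ h) * playedEstimate ℓ p h k) ≤
      3 * threshold ℓ h * roundCost n (round h) := by
    have hγ := implicitRate_nonneg ℓ h
    have hβ := explorationRate_pos hn (round h)
    calc _ ≤ ∑ _k : Fin n, (explorationRate n (round h) / n + implicitRate ℓ h) *
          (2 * threshold ℓ h) := Finset.sum_le_sum fun k _ => by
            rw [mul_left_comm]
            exact mul_le_mul_of_nonneg_left (mix_mul_playedEstimate_le hn hp h k) (by positivity)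
      _ = (explorationRate n (round h) + n * implicitRate ℓ h) * (2 * threshold ℓ h) := by
            simp only [Finset.sum_const, Finset.card_univ, Fintype.card_fin, nsmul_eq_mul]
            field_simp
      _ ≤ (roundCost n (round h) + roundCost n (round h) / 2) * (2 * threshold ℓ h) := by
            have := explorationRate_le_roundCost hn (t := round h) (by simp [round])
            have := nat_mul_implicitRate_le ℓ h
            gcongr
      _ = _ := by ring
  simp only [overhead, mul_add (mix p h _), Finset.sum_add_distrib]
  linarith

/-- One round of the regularized leader. -/
theorem objective_add_le (hn : 2 ≤ n) (hp : IsSCBIX ℓ p) (h : List (Fin n)) (k : Fin n)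
    {x : Fin n → ℝ} (hx : x ∈ stdSimplex ℝ (Fin n)) :
    objective ℓ p h (p h) + (p h k * playedEstimate ℓ p h k - stability ℓ p h k) ≤
      objective ℓ p (k :: h) x := by
  have hn₀ : 0 < n := by omega
  have hv : ∀ i, 0 ≤ lossEstimate ℓ p h k i := fun i => by
    rw [lossEstimate_eq]
    split_ifs
    exacts [playedEstimate_nonneg hn hp h i, le_rfl]
  -- Raising `1 / η` can only raise the objective, since `Ψ ≥ 0`; the term `log n` in `Ψ` ensures
  -- this.
  have hmono : ∑ i, (cumEstimate ℓ p h i + lossEstimate ℓ p h k i) * x i +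
      invLearningRate ℓ h * shannon x ≤ objective ℓ p (k :: h) x := by
    unfold objective
    simp only [cumEstimate]
    gcongr
    · exact shannon_nonneg hn₀ hx
    · exact invLearningRate_le_cons ℓ h k
  refine le_trans ?_ hmono
  have hmin : objective ℓ p h (p h) ≤ objective ℓ p h x := isMinOn_iff.1 (hp h).2 x hx
  have hfirst : objective ℓ p h (p h) ≤
      ∑ i, (cumEstimate ℓ p h i + lossEstimate ℓ p h k i) * x i +
        invLearningRate ℓ h * shannon x := by
    refine hmin.trans ?_
    unfold objective
    gcongr with i
    · exact hx.1 i
    · exact le_add_of_nonneg_right (hv i)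
  rcases min_choice (p h k * playedEstimate ℓ p h k)
    ((invLearningRate ℓ h)⁻¹ / 2 * (p h k * playedEstimate ℓ p h k ^ 2)) with hS | hS
  · rw [stability, hS, sub_self, add_zero]
    exact hfirst
  -- The entropic estimate needs `1 / η > 0`. Otherwise the threshold is zero, so the estimate
  -- vanishes and nothing has to be gained.
  rcases (invLearningRate_nonneg ℓ h).eq_or_lt with h0 | hpos
  · have hC : threshold ℓ h = 0 := by
      have hr : √((n : ℝ) * (round h : ℝ) / Real.log n) ≠ 0 := by
        have := log_natCast_pos hn
        have : 0 < (round h : ℝ) := by simp [round]; positivity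
        exact (Real.sqrt_pos.2 (by positivity)).ne'
      exact (mul_eq_zero.1 h0.symm).resolve_right hr
    have : playedEstimate ℓ p h k = 0 := by
      have h₁ := shiftedLoss_le ℓ h k
      have h₂ := shiftedLoss_nonneg ℓ h k
      rw [playedEstimate, (by linarith : shiftedLoss ℓ h k = 0), zero_div]
    rw [stability, this]
    simpa using hfirst
  · have := entropic_stability hn₀ hpos hv (hp h).1 (hp h).2 hx
    rw [stability, hS]
    simpa [lossEstimate_eq, objective, ite_pow] using this

/-- The minimal value of the objective is the potential. It starts at `0` because `1 / η_1 = 0`, and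
at the end it is compared with the vertex `i`, where `Ψ = log n`. -/
theorem runSum_sub_stability_le (hn : 2 ≤ n) (hp : IsSCBIX ℓ p) (h : List (Fin n)) (i : Fin n) :
    runSum (fun h k => p h k * playedEstimate ℓ p h k - stability ℓ p h k) h ≤
      cumEstimate ℓ p h i + invLearningRate ℓ h * Real.log n := by
  have h₁ := runSum_le_of_increment (T := h.length) (Φ := fun h => objective ℓ p h (p h))
    (f := fun h k => p h k * playedEstimate ℓ p h k - stability ℓ p h k)
    (by simp [objective, cumEstimate, invLearningRate, threshold])
    (fun h k _ => objective_add_le hn hp h k (hp (k :: h)).1) h le_rfl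
  have h₂ := isMinOn_iff.1 (hp h).2 _ (single_mem_stdSimplex ℝ i)
  refine (h₁.trans h₂).trans_eq ?_
  simp [objective, shannon_single, Pi.single_apply]

end Round

/-! ### Concentration -/

section Concentration

variable {n : ℕ} {ℓ : Adversary n} {p : Rule n}

/-- For `y` in `[0, 1]`, `exp y ≤ 1 + 2 y`, so the exponential moment is at most `1 + 2 μ ≤ exp (2
μ)`. Doubling the mean makes a variance estimate unnecessary. -/
theorem sum_mul_exp_sub_le_one {ι : Type*} {s : Finset ι} {q y : ι → ℝ} {μ : ℝ}
    (hq : ∀ k ∈ s, 0 ≤ q k) (hq₁ : ∑ k ∈ s, q k = 1) (hy : ∀ k ∈ s, 0 ≤ y k ∧ y k ≤ 1)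
    (hμ : ∑ k ∈ s, q k * y k ≤ μ) : ∑ k ∈ s, q k * Real.exp (y k - 2 * μ) ≤ 1 := by
  have hle : ∑ k ∈ s, q k * Real.exp (y k) ≤ Real.exp (2 * μ) := calc
    ∑ k ∈ s, q k * Real.exp (y k) ≤ ∑ k ∈ s, (q k + 2 * (q k * y k)) :=
      Finset.sum_le_sum fun k hk => by
        nlinarith [exp_le_one_add_two_mul (hy k hk).1 (hy k hk).2, hq k hk]
    _ = 1 + 2 * ∑ k ∈ s, q k * y k := by
      rw [Finset.sum_add_distrib, hq₁, Finset.mul_sum]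
    _ ≤ 2 * μ + 1 := by linarith
    _ ≤ Real.exp (2 * μ) := Real.add_one_le_exp _
  simp only [Real.exp_sub, ← mul_div_assoc, ← Finset.sum_div]
  exact div_le_one_of_le₀ hle (Real.exp_pos _).le

theorem sum_mul_exp_ite {ι : Type*} [Fintype ι] [DecidableEq ι] {q : ι → ℝ} (hq₁ : ∑ k, q k = 1)
    (i : ι) (x : ℝ) :
    ∑ k, q k * Real.exp (if i = k then x else 0) = 1 - q i + q i * Real.exp x := by
  have : ∀ k, q k * Real.exp (if i = k then x else 0) =
      q k + if i = k then q k * (Real.exp x - 1) else 0 := fun k => by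
    split_ifs
    · ring
    · simp
  simp only [this, Finset.sum_add_distrib, hq₁, Finset.sum_ite_eq, Finset.mem_univ, if_true]
  ring

/-- With thresholds at most `2 M`, the range `6 n C` becomes `12 n M` and the mean `7 C` times
`roundCost` becomes `14 M` times it. -/
theorem expect_exp_overhead_le_one (hn : 2 ≤ n) (hp : IsSCBIX ℓ p) {T : ℕ} {M : ℝ} (hM₀ : 0 < M)
    (hM : ∀ h i, h.length < T → |ℓ h i| ≤ M) :
    expect p T (fun h => Real.exp (runSum
      (fun h k => overhead ℓ p h k / (12 * n * M) - 2 * (14 * M * roundCost n (round h) /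
        (12 * n * M))) h)) ≤ 1 := by
  have hn' : (0 : ℝ) < n := by positivity
  refine expect_exp_runSum_le_one (fun h k => (mix_pos hn hp h k).le) T fun h hh => ?_
  have hC := threshold_le hM₀.le hM h hh.le
  have hs := roundCost_nonneg n (round h)
  refine sum_mul_exp_sub_le_one (fun k _ => (mix_pos hn hp h k).le) (sum_mix hn hp h)
    (fun k _ => ⟨div_nonneg (overhead_nonneg hn hp h k) (by positivity),
      div_le_one_of_le₀ ?_ (by positivity)⟩) ?_
  · refine (overhead_le hn hp h k).trans ?_
    nlinarith
  · simp only [← mul_div_assoc, ← Finset.sum_div]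
    refine div_le_div_of_nonneg_right ((sum_mix_mul_overhead_le hn hp h).trans ?_) (by positivity)
    nlinarith

theorem expect_exp_lossEstimate_le_one (hn : 2 ≤ n) (hp : IsSCBIX ℓ p) {T : ℕ} {M : ℝ}
    (hM₀ : 0 < M) (hM : ∀ h i, h.length < T → |ℓ h i| ≤ M) (i : Fin n) :
    expect p T (fun h => Real.exp (runSum
      (fun h k => √(Real.log n / ((n : ℝ) * T)) / 2 / (2 * M) *
        (lossEstimate ℓ p h k i - shiftedLoss ℓ h i)) h)) ≤ 1 := by
  have hn' : (0 : ℝ) < n := by positivity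
  refine expect_exp_runSum_le_one (fun h k => (mix_pos hn hp h k).le) T fun h hh => ?_
  have hC := threshold_le hM₀.le hM h hh.le
  have hu₀ := shiftedLoss_nonneg ℓ h i
  have hu := shiftedLoss_le ℓ h i
  set g := √(Real.log n / ((n : ℝ) * T)) / 2 with hg
  have hg₀ : 0 ≤ g := by positivity
  -- The supermartingale needs one fixed multiplier, so `g` is the smallest implicit rate, that of
  -- round `T`; the shifted loss is at most `2 C ≤ 4 M`. When the threshold is zero the rate is zero
  -- too, but so is the shifted loss.
  have hz : g / (2 * M) * shiftedLoss ℓ h i ≤ 2 * implicitRate ℓ h := by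
    by_cases h0 : threshold ℓ h = 0
    · rw [implicitRate, if_pos h0, (by linarith : shiftedLoss ℓ h i = 0)]
      simp
    · have hgγ : g ≤ implicitRate ℓ h := by
        rw [implicitRate, if_neg h0, hg]
        have hlog := log_natCast_pos hn
        have hr₀ : (0 : ℝ) < round h := by simp [round]; positivity
        have hr : (round h : ℝ) ≤ T := Nat.cast_le.2 hh
        gcongr
      rw [div_mul_eq_mul_div, div_le_iff₀ (by positivity)]
      nlinarith
  have hexp := implicit_exploration_exp_le (mix_pos hn hp h i)
    (mul_nonneg (div_nonneg hg₀ (by positivity)) hu₀) hz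
  have hterm : ∀ k, g / (2 * M) * (lossEstimate ℓ p h k i - shiftedLoss ℓ h i) =
      (if i = k then g / (2 * M) * shiftedLoss ℓ h i / (mix p h i + implicitRate ℓ h) else 0) -
        g / (2 * M) * shiftedLoss ℓ h i := fun k => by
    rw [lossEstimate_eq, playedEstimate]
    split_ifs <;> ring
  simp only [hterm, Real.exp_sub, ← mul_div_assoc, ← Finset.sum_div]
  rw [sum_mul_exp_ite (sum_mix hn hp h)]
  exact div_le_one_of_le₀ hexp (Real.exp_pos _).le

/-- Compares the excess of `i` over all rounds with its excess over the rounds in which `i` is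
played. For `x` in `[0, 1]`, `exp (-x) ≤ 1 - x / 2`, and `i` is drawn with probability at least `β_T
/ n`, so the moment is at most `1 - β_T x / (2 n) ≤ exp (-β_T x / (2 n))`. -/
theorem expect_exp_excess_le_one (hn : 2 ≤ n) (hp : IsSCBIX ℓ p) {T : ℕ} {M : ℝ}
    (hM₀ : 0 < M) (hM : ∀ h i, h.length < T → |ℓ h i| ≤ M) (i : Fin n) :
    expect p T (fun h => Real.exp (runSum
      (fun h k => (if i = k then -(excess ℓ h i / M) else 0) -
        -(explorationRate n T / n / (2 * M) * excess ℓ h i)) h)) ≤ 1 := by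
  have hn' : (0 : ℝ) < n := by positivity
  refine expect_exp_runSum_le_one (fun h k => (mix_pos hn hp h k).le) T fun h hh => ?_
  have he₀ : 0 ≤ excess ℓ h i / M := div_nonneg (excess_nonneg ℓ h i) hM₀.le
  have he₁ : excess ℓ h i / M ≤ 1 := by
    refine div_le_one_of_le₀ (max_le ?_ hM₀.le) hM₀.le
    linarith [hM h i hh, threshold_nonneg ℓ h]
  have hq : explorationRate n T / n ≤ mix p h i :=
    (div_le_div_of_nonneg_right (explorationRate_anti hn hh) hn'.le).trans
      (explorationRate_div_le_mix hn hp h i)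
  simp only [Real.exp_sub, ← mul_div_assoc, ← Finset.sum_div]
  rw [sum_mul_exp_ite (sum_mix hn hp h)]
  refine div_le_one_of_le₀ ?_ (Real.exp_pos _).le
  have h₁ := exp_neg_le_quadratic he₀
  have h₂ := Real.add_one_le_exp (-(explorationRate n T / n / (2 * M) * excess ℓ h i))
  have h₃ : explorationRate n T / n / (2 * M) * excess ℓ h i =
      explorationRate n T / n * (excess ℓ h i / M) / 2 := by field_simp
  rw [h₃] at h₂ ⊢
  have h₄ := mul_le_mul_of_nonneg_left h₁ (mix_pos hn hp h i).le
  have h₅ := mix_pos hn hp h i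
  have h₆ := mul_le_mul_of_nonneg_right hq he₀
  have h₇ : mix p h i * (excess ℓ h i / M) ^ 2 ≤ mix p h i * (excess ℓ h i / M) := by
    gcongr
    nlinarith
  nlinarith

end Concentration

/-! ### The regret bound -/

section Regret

variable {n : ℕ} {ℓ : Adversary n} {p : Rule n}

theorem abs_le_lossScale (ℓ : Adversary n) (T : ℕ) (h : List (Fin n)) (i : Fin n)
    (hh : h.length < T) : |ℓ h i| ≤ lossScale ℓ T :=
  le_ciSup (f := fun x : (Σ t : Fin T, List.Vector (Fin n) t) × Fin n => |ℓ x.1.2.toList x.2|)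
    (Set.finite_range _).bddAbove (⟨⟨h.length, hh⟩, ⟨h, rfl⟩⟩, i)

theorem regret_le_of_forall (hn : 0 < n) {h : List (Fin n)} {X : ℝ}
    (hX : ∀ i, playerLoss ℓ h - actionLoss ℓ i h ≤ X) : regret ℓ h ≤ X := by
  have : Nonempty (Fin n) := ⟨⟨0, hn⟩⟩
  have : playerLoss ℓ h - X ≤ ⨅ i, actionLoss ℓ i h := le_ciInf fun i => by linarith [hX i]
  unfold regret
  linarith

theorem regret_le_two_mul (hn : 0 < n) {T : ℕ} {M : ℝ} (hM : ∀ h i, h.length < T → |ℓ h i| ≤ M)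
    {h : List (Fin n)} (hh : h.length = T) : regret ℓ h ≤ 2 * M * T := by
  refine regret_le_of_forall hn fun i => ?_
  rw [playerLoss_eq_runSum, actionLoss_eq_runSum, ← runSum_sub]
  refine (runSum_le_of_increment (Φ := fun h => 2 * M * h.length) (by simp)
    (fun h k hlt => ?_) h hh.le).trans_eq (by rw [hh])
  have h₁ := abs_le.1 (hM h k hlt)
  have h₂ := abs_le.1 (hM h i hlt)
  push_cast [List.length_cons]
  linarith

/-- The regret against a fixed action, in terms of the quantities that concentrate. -/
theorem playerLoss_sub_actionLoss_le (hn : 2 ≤ n) (hp : IsSCBIX ℓ p) (h : List (Fin n))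
    (i : Fin n) :
    playerLoss ℓ h - actionLoss ℓ i h ≤
      threshold ℓ h + invLearningRate ℓ h * Real.log n + runSum (overhead ℓ p) h +
        (cumEstimate ℓ p h i - runSum (fun h _ => shiftedLoss ℓ h i) h) +
        runSum (fun h _ => excess ℓ h i) h := by
  have h₁ := runSum_sub_stability_le hn hp h i
  have h₂ := runSum_excess_le ℓ h
  -- The shift by the threshold is the same for `k` and `i` and cancels here.
  have h₃ : runSum (fun h k => ℓ h k - ℓ h i) h ≤
      runSum (fun h k => (excess ℓ h k +
        ((p h k * playedEstimate ℓ p h k - stability ℓ p h k) + overhead ℓ p h k)) +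
        (excess ℓ h i - shiftedLoss ℓ h i)) h := by
    refine runSum_le_runSum (T := h.length) (fun h k _ => ?_) h le_rfl
    have := (abs_le.1 (abs_shiftedLoss_sub_le ℓ h k)).1
    have := (abs_le.1 (abs_shiftedLoss_sub_le ℓ h i)).2
    have := shiftedLoss_le_add_overhead hn hp h k
    linarith
  simp only [runSum_add, runSum_sub (fun h _ => excess ℓ h i),
    runSum_sub ℓ (fun h _ => ℓ h i)] at h₃
  rw [playerLoss_eq_runSum, actionLoss_eq_runSum]
  linarith

theorem regret_le_of_concentration (hn : 2 ≤ n) (hp : IsSCBIX ℓ p) {T : ℕ} {M Λ : ℝ}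
    (hM₀ : 0 < M) (hM : ∀ h i, h.length < T → |ℓ h i| ≤ M) (hT : n * Real.log n ≤ T)
    (hΛ : 0 ≤ Λ) {h : List (Fin n)} (hh : h.length = T)
    (hover : runSum (fun h k => overhead ℓ p h k / (12 * n * M) -
      2 * (14 * M * roundCost n (round h) / (12 * n * M))) h ≤ Λ)
    (hest : ∀ i, runSum (fun h k => √(Real.log n / ((n : ℝ) * T)) / 2 / (2 * M) *
        (lossEstimate ℓ p h k i - shiftedLoss ℓ h i)) h ≤ Λ)
    (hexc : ∀ i, runSum (fun h k => (if i = k then -(excess ℓ h i / M) else 0) -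
        -(explorationRate n T / n / (2 * M) * excess ℓ h i)) h ≤ Λ) :
    regret ℓ h ≤ M * √((n : ℝ) * T / Real.log n) * (80 * Real.log n + 20 * Λ) := by
  have hn₂ : (2 : ℝ) ≤ n := by exact_mod_cast hn
  have hn₀ : (0 : ℝ) < n := by positivity
  have hlog := log_natCast_pos hn
  have hlog₂ : 1 / 2 ≤ Real.log n := by
    have := Real.log_le_log two_pos hn₂
    linarith [Real.log_two_gt_d9]
  have hT₀ : (0 : ℝ) < T := (mul_pos hn₀ hlog).trans_le hT
  set A := √((n : ℝ) * T / Real.log n) with hA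
  have hA₀ : 0 < A := Real.sqrt_pos.2 (by positivity)
  have hAsq : A ^ 2 = n * T / Real.log n := Real.sq_sqrt (by positivity)
  -- Uses `n log n ≤ T`; it absorbs the range `12 n M` of the overhead into `M * A`.
  have hnA : n ≤ A := by
    refine Real.le_sqrt_of_sq_le ?_
    rw [le_div_iff₀ hlog]
    nlinarith
  have hAlog : √((n : ℝ) * T * Real.log n) = A * Real.log n := by
    rw [← Real.sqrt_sq (by positivity : 0 ≤ A * Real.log n), mul_pow, hAsq]
    congr 1
    field_simp
  have hC := threshold_le hM₀.le hM h hh.le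
  refine regret_le_of_forall (by omega) fun i => ?_
  have hmain := playerLoss_sub_actionLoss_le hn hp h i
  have hY : runSum (overhead ℓ p) h ≤ 12 * n * M * Λ + 56 * M * (A * Real.log n) := by
    have e : (fun (h : List (Fin n)) (k : Fin n) => overhead ℓ p h k / (12 * n * M) -
        2 * (14 * M * roundCost n (round h) / (12 * n * M))) =
        fun h k => (12 * n * M)⁻¹ * (overhead ℓ p h k - 28 * M * roundCost n (round h)) := by
      funext h k
      ring
    rw [e, runSum_const_mul, inv_mul_le_iff₀ (by positivity), runSum_sub (overhead ℓ p),
      runSum_const_mul] at hover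
    have hcost := runSum_roundCost_le h
    rw [hh, hAlog] at hcost
    nlinarith
  have hW : cumEstimate ℓ p h i - runSum (fun h _ => shiftedLoss ℓ h i) h ≤ 4 * M * A * Λ := by
    have h₁ := hest i
    rw [runSum_const_mul, runSum_sub (fun h k => lossEstimate ℓ p h k i),
      ← cumEstimate_eq_runSum] at h₁
    have e : √(Real.log n / ((n : ℝ) * T)) / 2 / (2 * M) = (4 * M * A)⁻¹ := by
      rw [← inv_div ((n : ℝ) * T), Real.sqrt_inv, ← hA]
      field_simp
      norm_num
    rwa [e, inv_mul_le_iff₀ (by positivity)] at h₁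
  have hV : runSum (fun h _ => excess ℓ h i) h ≤ 4 * M * A * (Λ + 2) := by
    have h₁ := hexc i
    rw [runSum_sub (fun h k => if i = k then -(excess ℓ h i / M) else 0)] at h₁
    have e₂ : (fun (h : List (Fin n)) (_ : Fin n) =>
        -(explorationRate n T / n / (2 * M) * excess ℓ h i)) =
        fun h _ => -(explorationRate n T / n / (2 * M)) * excess ℓ h i := by
      funext h k
      ring
    rw [e₂, runSum_const_mul] at h₁
    -- The excess of `i` when played is part of the total played excess, which is at most the final
    -- threshold, hence at most `2 M`.
    have h₂ : -2 ≤ runSum (fun h k => if i = k then -(excess ℓ h i / M) else 0) h := by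
      have hle : runSum (fun h k => (-M⁻¹) * excess ℓ h k) h ≤
          runSum (fun h k => if i = k then -(excess ℓ h i / M) else 0) h := by
        refine runSum_le_runSum (T := h.length) (fun h k _ => ?_) h le_rfl
        have := div_nonneg (excess_nonneg ℓ h k) hM₀.le
        split_ifs with hik
        · subst hik
          exact le_of_eq (by ring)
        · rw [div_eq_inv_mul] at this
          linarith
      rw [runSum_const_mul] at hle
      have : M⁻¹ * runSum (excess ℓ) h ≤ 2 := by
        rw [inv_mul_le_iff₀ hM₀]
        linarith [runSum_excess_le ℓ h]
      have e₃ : runSum (fun h k => excess ℓ h k) h = runSum (excess ℓ) h := rfl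
      rw [e₃] at hle
      linarith
    have hV₀ : 0 ≤ runSum (fun h _ => excess ℓ h i) h := by
      have := runSum_le_runSum (T := h.length) (f := fun _ _ => 0) (g := fun h _ => excess ℓ h i)
        (fun h k _ => excess_nonneg ℓ h i) h le_rfl
      have e₀ := runSum_const_mul 0 (fun _ _ => 0) h
      simp only [zero_mul] at e₀
      rwa [e₀] at this
    -- Since `n log n ≤ T`, the denominator in `β_T` is at most `2 T ≤ 4 T`, and `√(n log n / (4 T))
    -- = n / (2 A)`.
    have hβ : (2 * A)⁻¹ ≤ explorationRate n T / n := by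
      have hsq : 1 / (2 * A / n) ≤ explorationRate n T := by
        refine Real.le_sqrt_of_sq_le ?_
        have e₁ : (1 / (2 * A / n)) ^ 2 = n * Real.log n / (4 * T) := by
          rw [div_pow, div_pow, mul_pow, hAsq]
          field_simp
          norm_num
        rw [e₁]
        exact div_le_div_of_nonneg_left (by positivity) (by positivity) (by linarith)
      rw [le_div_iff₀ hn₀]
      refine le_trans (le_of_eq ?_) hsq
      field_simp
    have h₃ : (4 * M * A)⁻¹ * runSum (fun h _ => excess ℓ h i) h ≤ Λ + 2 := by
      have e₄ : (4 * M * A)⁻¹ = (2 * A)⁻¹ / (2 * M) := by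
        field_simp
        norm_num
      have := mul_le_mul_of_nonneg_right
        (div_le_div_of_nonneg_right hβ (by positivity : 0 ≤ 2 * M)) hV₀
      rw [e₄]
      linarith
    rwa [inv_mul_le_iff₀ (by positivity)] at h₃
  -- After `T` rounds the rate is that of round `T + 1`, hence the slack `T + 1 ≤ 4 T`.
  have hη : invLearningRate ℓ h ≤ 4 * M * A := by
    have hsq : √((n : ℝ) * (round h : ℝ) / Real.log n) ≤ 2 * A := by
      refine Real.sqrt_le_iff.2 ⟨by positivity, ?_⟩
      have hT₁ : (1 : ℝ) ≤ T := by exact_mod_cast (Nat.cast_pos.1 hT₀)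
      have hr : (round h : ℝ) ≤ 4 * T := by
        rw [round, hh]
        push_cast
        linarith
      rw [mul_pow, hAsq, ← mul_div_assoc]
      refine div_le_div_of_nonneg_right ?_ hlog.le
      nlinarith
    unfold invLearningRate
    nlinarith [threshold_nonneg ℓ h]
  have hηlog := mul_le_mul_of_nonneg_right hη hlog.le
  have hMA : 0 < M * A := by positivity
  have hnM : 12 * n * M * Λ ≤ 12 * (M * A) * Λ := by
    refine mul_le_mul_of_nonneg_right ?_ hΛ
    nlinarith
  have hM2 : 2 * M ≤ M * A := by nlinarith
  have hMAlog : M * A * (1 / 2) ≤ M * A * Real.log n := mul_le_mul_of_nonneg_left hlog₂ hMA.le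
  -- The coefficient of `Λ` is `12 + 4 + 4 = 20`. That of `log n` is `56 + 4`, plus at most `18`
  -- from the constants `2 M + 8 M A ≤ 9 M A`, by `log n ≥ 1 / 2`.
  nlinarith

theorem one_sub_le_prob_regret (hn : 2 ≤ n) (hp : IsSCBIX ℓ p) {T : ℕ} {M δ : ℝ}
    (hM₀ : 0 < M) (hM : ∀ h i, h.length < T → |ℓ h i| ≤ M) (hT : n * Real.log n ≤ T)
    (hδ : 0 < δ) (hδ₁ : δ < 1) :
    1 - δ ≤ prob p T (fun h => regret ℓ h ≤
      M * √((n : ℝ) * T / Real.log n) * (140 * Real.log n + 20 * Real.log (1 / δ))) := by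
  have hn₂ : (2 : ℝ) ≤ n := by exact_mod_cast hn
  have hn₀ : (0 : ℝ) < n := by positivity
  set F : List (Fin n) → Fin n → ℝ := fun h k => overhead ℓ p h k / (12 * n * M) -
      2 * (14 * M * roundCost n (round h) / (12 * n * M)) with hF
  set G : Fin n → List (Fin n) → Fin n → ℝ := fun i h k =>
      √(Real.log n / ((n : ℝ) * T)) / 2 / (2 * M) *
        (lossEstimate ℓ p h k i - shiftedLoss ℓ h i) with hG
  set H : Fin n → List (Fin n) → Fin n → ℝ := fun i h k =>
      (if i = k then -(excess ℓ h i / M) else 0) -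
        -(explorationRate n T / n / (2 * M) * excess ℓ h i) with hH
  have hpos : ∀ (f : Fin n → List (Fin n) → Fin n → ℝ) h,
      0 ≤ ∑ i, Real.exp (runSum (f i) h) :=
    fun f h => Finset.sum_nonneg fun i _ => (Real.exp_pos _).le
  have hcard : ∀ f : Fin n → List (Fin n) → Fin n → ℝ,
      (∀ i, expect p T (fun h => Real.exp (runSum (f i) h)) ≤ 1) →
      expect p T (fun h => ∑ i, Real.exp (runSum (f i) h)) ≤ n := fun f hf => by
    rw [expect_sum]
    refine (Finset.sum_le_sum fun i _ => hf i).trans ?_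
    simp
  refine one_sub_le_prob (fun h k => (mix_pos hn hp h k).le) (sum_mix hn hp)
    (Z := fun h => Real.exp (runSum F h) +
      (∑ i, Real.exp (runSum (G i) h) + ∑ i, Real.exp (runSum (H i) h)))
    -- The expectation is at most `2 n + 1 ≤ n ^ 3`. A pure power makes `Λ = 3 log n + log (1 / δ)`,
    -- and `80 + 20 * 3 = 140`.
    (by positivity : (0 : ℝ) < (n : ℝ) ^ 3) hδ ?_ ?_ ?_
  · intro h
    have := hpos G h
    have := hpos H h
    positivity
  · rw [expect_add, expect_add]
    have h₁ := expect_exp_overhead_le_one hn hp hM₀ hM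
    have h₂ := hcard G (expect_exp_lossEstimate_le_one hn hp hM₀ hM)
    have h₃ := hcard H (expect_exp_excess_le_one hn hp hM₀ hM)
    have h₄ : 1 + ((n : ℝ) + n) ≤ (n : ℝ) ^ 3 := by nlinarith [sq_nonneg ((n : ℝ) - 2)]
    linarith
  · intro h hh hZ
    have hlogδ : 0 ≤ Real.log (1 / δ) := Real.log_nonneg ((one_le_div hδ).2 hδ₁.le)
    have hΛ : Real.log ((n : ℝ) ^ 3 / δ) = 3 * Real.log n + Real.log (1 / δ) := by
      rw [Real.log_div (by positivity) hδ.ne', Real.log_pow, one_div, Real.log_inv]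
      push_cast
      ring
    have hle : ∀ x, Real.exp x ≤ (n : ℝ) ^ 3 / δ → x ≤ 3 * Real.log n + Real.log (1 / δ) :=
      fun x hx => hΛ ▸ (Real.le_log_iff_exp_le (by positivity)).2 hx
    have hsingle : ∀ (f : Fin n → List (Fin n) → Fin n → ℝ) i,
        Real.exp (runSum (f i) h) ≤ ∑ i, Real.exp (runSum (f i) h) := fun f i =>
      Finset.single_le_sum (f := fun i => Real.exp (runSum (f i) h))
        (fun i _ => (Real.exp_pos _).le) (Finset.mem_univ i)
    have hE := Real.exp_pos (runSum F h)
    have := regret_le_of_concentration hn hp hM₀ hM hT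
      (Λ := 3 * Real.log n + Real.log (1 / δ))
      (by linarith [log_natCast_pos hn]) hh
      (hle _ (by linarith [hpos G h, hpos H h]))
      (fun i => hle _ (by linarith [hpos H h, hsingle G i]))
      (fun i => hle _ (by linarith [hpos G h, hsingle H i]))
    refine this.trans_eq ?_
    ring

end Regret

end SCBIX

theorem theorem2 :
    ∃ c : ℝ, 0 < c ∧
      ∀ (n T : ℕ), 2 ≤ n → 1 ≤ T →
      ∀ (ℓ : SCBIX.Adversary n) (p : SCBIX.Rule n), SCBIX.IsSCBIX ℓ p →
      ∀ δ : ℝ, 0 < δ → δ < 1 →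
        1 - δ ≤ SCBIX.prob p T (fun h =>
          SCBIX.regret ℓ h ≤
            c * (SCBIX.lossScale ℓ T * √(((n : ℝ) ^ 2 + n * T) / Real.log n) * Real.log (1 / δ)
              + SCBIX.lossScale ℓ T * √((n : ℝ) * T * Real.log n))) := by
  refine ⟨140, by norm_num, fun n T hn hT ℓ p hp δ hδ hδ₁ => ?_⟩
  have hM := SCBIX.abs_le_lossScale ℓ T
  set M := SCBIX.lossScale ℓ T with hMdef
  have hn₀ : 0 < n := by omega
  have hM₀ : 0 ≤ M := (abs_nonneg _).trans (hM [] ⟨0, hn₀⟩ hT)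
  have hlog := SCBIX.log_natCast_pos hn
  have hlogδ : 0 ≤ Real.log (1 / δ) := Real.log_nonneg ((one_le_div hδ).2 hδ₁.le)
  have hn' : (0 : ℝ) < n := Nat.cast_pos.2 hn₀
  have hq : ∀ h k, 0 ≤ SCBIX.mix p h k := fun h k => (SCBIX.mix_pos hn hp h k).le
  have hfirst : 0 ≤ M * √(((n : ℝ) ^ 2 + n * T) / Real.log n) * Real.log (1 / δ) := by positivity
  by_cases hcase : 0 < M ∧ n * Real.log n ≤ T
  · refine (SCBIX.one_sub_le_prob_regret hn hp hcase.1 hM hcase.2 hδ hδ₁).trans ?_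
    refine Finset.sum_le_sum fun a _ => ?_
    have hA : M * √((n : ℝ) * T / Real.log n) * (140 * Real.log n + 20 * Real.log (1 / δ)) ≤
        140 * (M * √(((n : ℝ) ^ 2 + n * T) / Real.log n) * Real.log (1 / δ)
          + M * √((n : ℝ) * T * Real.log n)) := by
      have h₁ : √((n : ℝ) * T * Real.log n) = √((n : ℝ) * T / Real.log n) * Real.log n := by
        rw [← Real.sqrt_sq hlog.le, ← Real.sqrt_mul (by positivity), Real.sqrt_sq hlog.le]
        congr 1
        field_simp
      have h₂ : M * √((n : ℝ) * T / Real.log n) * Real.log (1 / δ) ≤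
          M * √(((n : ℝ) ^ 2 + n * T) / Real.log n) * Real.log (1 / δ) := by
        gcongr
        linarith [sq_nonneg (n : ℝ)]
      rw [h₁]
      linarith
    have hprob := SCBIX.playProb_nonneg hq a.toList
    split_ifs with h₁ h₂ h₂
    exacts [le_rfl, absurd (h₁.trans hA) h₂, hprob, le_rfl]
  -- Here the bound holds on every history, so Markov's inequality is applied to `Z = 0`. Either `M
  -- = 0`, or `T < n log n` and then `T ≤ √(n T log n)`.
  · refine SCBIX.one_sub_le_prob hq (SCBIX.sum_mix hn hp) (Z := fun _ => 0) zero_lt_one hδ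
      (fun _ => le_rfl) (by simp [SCBIX.expect]) fun h hh _ => ?_
    refine (SCBIX.regret_le_two_mul hn₀ hM hh).trans ?_
    have hMT : M * T ≤ M * √((n : ℝ) * T * Real.log n) := by
      rcases hM₀.eq_or_lt with h0 | hpos
      · rw [← h0, zero_mul, zero_mul]
      · have hlt : (T : ℝ) < n * Real.log n := lt_of_not_ge fun h => hcase ⟨hpos, h⟩
        refine mul_le_mul_of_nonneg_left (Real.le_sqrt_of_sq_le ?_) hM₀
        nlinarith [(Nat.cast_nonneg T : (0 : ℝ) ≤ T)]
    have := mul_nonneg hM₀ (T.cast_nonneg : (0 : ℝ) ≤ T)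
    linarith
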